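/- Let $\Gamma$ be a nonempty semigroup and let $I_1, I_2$ be finite sets. For each $i\in I_1$, let $V_i$ be a Euclidean space of finite dimension $\geq 2$ and $\rho_i:\Gamma\to\mathrm{GL}(V_i)$ a representation (i.e. a semigroup homomorphism) such that $\rho_i(\Gamma)$ acts strongly irreducibly on $V_i$, i.e. does not preserve any finite union of linear subspaces of $V_i$ apart from $\{0\}$ and $V_i$. For each $i\in I_2$, let $M_i$ be a Gromov hyperbolic metric space (not assumed to be proper nor geodesic), with Gromov boundary $\partial_\infty M_i$, and let $\rho_i:\Gamma\to\mathrm{Isom}(M_i)$ be a representation such that $\rho_i(\Gamma)$ does not have a unique global fixed point in $\partial_\infty M_i$. An isometry $g$ of $M_i$ is called hyperbolic if it has two distinct fixed points $x_g^+,x_g^-$ in $\partial_\infty M_i$ such that $g^n\cdot m\to x_g^{\pm}$ as $n\to\pm\infty$ for all $m\in (M_i\cup\partial_\infty M_i)\smallsetminus\{x_g^{\mp}\}$. Let $I_2'$ be the set of those $i\in I_2$ for which $\rho_i(\Gamma)$ is of general type, i.e. contains two hyperbolic isometries with no common fixed point in $\partial_\infty M_i$. For $i\in I_1$, say that a point of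 $\mathbb{P}(V_i)$ and a point of $\mathbb{P}(V_i^*)$ (seen as a projective hyperplane of $\mathbb{P}(V_i)$) are transverse if the point does not belong to the hyperplane; for $i\in I_2'$, say that two points of $\partial_\infty M_i$ are transverse if they are distinct. Then the following condition always holds: (*) for any finite sets $\mathcal{Z}_i^+$, $i\in I_1\cup I_2'$, of points of $\mathbb{P}(V_i)$ (for $i\in I_1$) or $\partial_\infty M_i$ (for $i\in I_2'$), and any finite sets $\mathcal{Z}_i^-$, $i\in I_1\cup I_2'$, of points of $\mathbb{P}(V_i^*)$ (for $i\in I_1$) or $\partial_\infty M_i$ (for $i\in I_2'$), there exists $\gamma\in\Gamma$ such that $\rho_i(\gamma)\cdot z_i^+$ is transverse to $z_i^-$ and $z_i^+$ is transverse to $\rho_i(\gamma)\cdot z_i^-$ for all $z_i^+\in\mathcal{Z}_i^+$ and all $z_i^-\in\mathcal{Z}_i^-$, simultaneously for all $i\in I_1\cup I_2'$. -/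

import Mathlib

open Filter Topology Module
open scoped LinearAlgebra.Projectivization

noncomputable section

/-! ### The linear side -/

section Linear

variable {V : Type*} [AddCommGroup V] [Module ℝ V]

/-- A set `S` of elements of `GL(V)` acts strongly irreducibly on `V` if it does not preserve any
finite union of linear subspaces of `V` apart from `{0}` and `V`. -/
def ActsStronglyIrreducibly (S : Set (LinearMap.GeneralLinearGroup ℝ V)) : Prop :=
  ∀ F : Finset (Submodule ℝ V), F.Nonempty →
    (∀ g ∈ S, ∀ v ∈ ⋃ W ∈ F, (W : Set V), g • v ∈ ⋃ W ∈ F, (W : Set V)) →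
      (⋃ W ∈ F, (W : Set V)) = {0} ∨ (⋃ W ∈ F, (W : Set V)) = Set.univ

/-- The action of `GL(V)` on `ℙ(V*)`, induced by `φ ↦ φ ∘ g⁻¹`: it sends the hyperplane `ker φ`
to the hyperplane `g (ker φ)`. -/
def dualProjAct (g : LinearMap.GeneralLinearGroup ℝ V) (z : ℙ ℝ (Dual ℝ V)) : ℙ ℝ (Dual ℝ V) :=
  z.map g.toLinearEquiv.symm.dualMap.toLinearMap g.toLinearEquiv.symm.dualMap.injective

/-- A point of `ℙ(V)` and a point of `ℙ(V*)` are transverse if the point does not belong to the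
hyperplane. -/
def ProjTransverse (z : ℙ ℝ V) (w : ℙ ℝ (Dual ℝ V)) : Prop :=
  ¬ z.submodule ≤ w.submodule.dualCoannihilator

end Linear

/-! ### Gromov hyperbolic metric spaces and their boundary -/

section Gromov

/-- The Gromov product `(m|p)_q`. -/
def gromovProd {M : Type*} [MetricSpace M] (m p q : M) : ℝ :=
  (dist m q + dist p q - dist m p) / 2

/-- Gromov hyperbolic metric spaces (neither proper nor geodesic in general). -/
class GromovHyperbolic (M : Type*) [MetricSpace M] : Prop where
  exists_delta : ∃ δ : ℝ, 0 < δ ∧ ∃ o : M, ∀ m p q : M,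
    min (gromovProd m q o) (gromovProd p q o) - δ ≤ gromovProd m p o

variable {M : Type*} [MetricSpace M]

theorem gromovProd_le_add_dist (m p o o' : M) :
    gromovProd m p o ≤ gromovProd m p o' + dist o o' := by
  have h1 := dist_triangle m o' o
  have h2 := dist_triangle p o' o
  rw [dist_comm o' o] at h1 h2
  unfold gromovProd
  linarith

theorem tendsto_gromovProd_basepoint {α : Type*} {l : Filter α} {f g : α → M} (o o' : M)
    (h : Tendsto (fun a => gromovProd (f a) (g a) o) l atTop) :
    Tendsto (fun a => gromovProd (f a) (g a) o') l atTop := by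
  refine tendsto_atTop_mono (fun a => ?_) (tendsto_atTop_add_const_right l (-dist o o') h)
  have := gromovProd_le_add_dist (f a) (g a) o o'
  linarith

theorem gromovProd_isometryEquiv (g : M ≃ᵢ M) (m p o : M) :
    gromovProd (g m) (g p) o = gromovProd m p (g.symm o) := by
  have h : ∀ x, dist (g x) o = dist x (g.symm o) := fun x => by
    rw [← g.dist_eq x (g.symm o), g.apply_symm_apply]
  simp only [gromovProd, h, g.dist_eq]

variable (M) in
/-- Gromov sequences: `(uₙ|uₘ)_o → +∞` as `n, m → +∞`, for one basepoint `o` or, equivalently,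
for all of them. -/
def GromovSeq : Type _ :=
  {u : ℕ → M // ∀ o : M, Tendsto (fun k : ℕ × ℕ => gromovProd (u k.1) (u k.2) o) atTop atTop}

variable (M) in
/-- Equivalence of Gromov sequences: `(uₙ|vₙ)_o → +∞`, for one basepoint `o` or, equivalently,
for all of them. -/
instance gromovSetoid [GromovHyperbolic M] : Setoid (GromovSeq M) where
  r u v := ∀ o : M, Tendsto (fun n => gromovProd (u.1 n) (v.1 n) o) atTop atTop
  iseqv :=
    { refl := fun u o => (u.2 o).comp (tendsto_atTop_diagonal (α := ℕ))
      symm := fun {u v} h o => by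
        refine (h o).congr fun n => ?_
        simp only [gromovProd, dist_comm (u.1 n) (v.1 n)]
        ring
      trans := fun {u v w} huv hvw o' => by
        obtain ⟨δ, -, o, h⟩ := GromovHyperbolic.exists_delta (M := M)
        refine tendsto_gromovProd_basepoint o o' (tendsto_atTop.2 fun b => ?_)
        filter_upwards [tendsto_atTop.1 (huv o) (b + δ), tendsto_atTop.1 (hvw o) (b + δ)]
          with n h1 h2
        have h3 := h (u.1 n) (w.1 n) (v.1 n)
        have h4 : gromovProd (w.1 n) (v.1 n) o = gromovProd (v.1 n) (w.1 n) o := by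
          simp only [gromovProd, dist_comm (w.1 n) (v.1 n)]
          ring
        have h5 := le_min h1 (h4 ▸ h2)
        linarith }

variable (M) in
/-- The Gromov boundary `∂∞M`. -/
def GromovBoundary [GromovHyperbolic M] : Type _ := Quotient (gromovSetoid M)

/-- The image of a Gromov sequence under an isometry. -/
def GromovSeq.map (g : M ≃ᵢ M) (u : GromovSeq M) : GromovSeq M :=
  ⟨fun n => g (u.1 n), fun o => by
    simpa only [gromovProd_isometryEquiv] using u.2 (g.symm o)⟩

variable [GromovHyperbolic M]

/-- The action of `Isom(M)` on `∂∞M`. -/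
instance : MulAction (M ≃ᵢ M) (GromovBoundary M) where
  smul g := Quotient.map (GromovSeq.map g) fun u v h o => by
    simpa only [GromovSeq.map, gromovProd_isometryEquiv] using h (g.symm o)
  one_smul x := Quotient.inductionOn x fun _ => rfl
  mul_smul _ _ x := Quotient.inductionOn x fun _ => rfl

/-- The sequences representing a point of the bordification `M ∪ ∂∞M`: the constant sequence for a
point of `M`, the Gromov sequences in the class for a point of `∂∞M`. -/
def reprSeqs : M ⊕ GromovBoundary M → Set (ℕ → M)
  | Sum.inl m => {fun _ => m}
  | Sum.inr x => {u | ∃ v : GromovSeq M, v.1 = u ∧ Quotient.mk (gromovSetoid M) v = x}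

/-- The Gromov product `(x|y)_o` extended to `M ∪ ∂∞M`, with values in `[-∞, +∞]`. -/
def extGromovProd (x y : M ⊕ GromovBoundary M) (o : M) : EReal :=
  ⨅ u ∈ reprSeqs x, ⨅ v ∈ reprSeqs y,
    liminf (fun n => ((gromovProd (u n) (v n) o : ℝ) : EReal)) atTop

/-- Convergence of a sequence of `M ∪ ∂∞M` to a point `x` of `∂∞M`, for the topology in which the
sets `{y | (y|x)_o > t}` form a basis of neighborhoods of `x`. -/
def ConvergesToBdry (y : ℕ → M ⊕ GromovBoundary M) (x : GromovBoundary M) : Prop :=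
  ∀ (o : M) (t : ℝ), ∀ᶠ n in atTop, (t : EReal) < extGromovProd (y n) (Sum.inr x) o

/-- The action of an isometry on `M ∪ ∂∞M`. -/
def bordAct (g : M ≃ᵢ M) : M ⊕ GromovBoundary M → M ⊕ GromovBoundary M :=
  Sum.map g (fun x => g • x)

/-- Hyperbolic isometries: two fixed points `x⁺ ≠ x⁻` in `∂∞M`, such that `gⁿ y → x⁺`
for all `y ≠ x⁻` and `g⁻ⁿ y → x⁻` for all `y ≠ x⁺` in `M ∪ ∂∞M`, as `n → +∞`. -/
def IsHyperbolicIsometry (g : M ≃ᵢ M) : Prop :=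
  ∃ xp xm : GromovBoundary M, xp ≠ xm ∧ g • xp = xp ∧ g • xm = xm ∧
    (∀ y : M ⊕ GromovBoundary M, y ≠ Sum.inr xm →
      ConvergesToBdry (fun n => bordAct (g ^ n) y) xp) ∧
    (∀ y : M ⊕ GromovBoundary M, y ≠ Sum.inr xp →
      ConvergesToBdry (fun n => bordAct (g⁻¹ ^ n) y) xm)

/-- A set of isometries is of general type if it contains two hyperbolic isometries with no common
fixed point in `∂∞M`. -/
def IsOfGeneralType (S : Set (M ≃ᵢ M)) : Prop :=
  ∃ g ∈ S, ∃ h ∈ S, IsHyperbolicIsometry g ∧ IsHyperbolicIsometry h ∧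
    ∀ x : GromovBoundary M, ¬ (g • x = x ∧ h • x = x)

end Gromov

/-! ### Moving points into transverse position -/

/-- Condition (*): finitely many points and hyperplanes, respectively boundary points, can be moved
into transverse position by one `γ`, simultaneously in all linear factors `i : I₁` and in all
hyperbolic factors `i : I₂` for which the image of `Γ` is of general type. -/
def ConditionStar {Γ : Type*} [Semigroup Γ] {I₁ I₂ : Type*}
    {V : I₁ → Type*} [∀ i, AddCommGroup (V i)] [∀ i, Module ℝ (V i)]
    {M : I₂ → Type*} [∀ i, MetricSpace (M i)] [∀ i, GromovHyperbolic (M i)]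
    (ρ : ∀ i, Γ →ₙ* LinearMap.GeneralLinearGroup ℝ (V i)) (σ : ∀ i, Γ →ₙ* (M i ≃ᵢ M i)) : Prop :=
  ∀ (Zp : ∀ i, Finset (ℙ ℝ (V i))) (Zm : ∀ i, Finset (ℙ ℝ (Dual ℝ (V i))))
    (Yp Ym : ∀ i : {i : I₂ // IsOfGeneralType (Set.range (σ i))},
      Finset (GromovBoundary (M i.1))),
    ∃ γ : Γ,
      (∀ i, ∀ zp ∈ Zp i, ∀ zm ∈ Zm i,
        ProjTransverse (ρ i γ • zp) zm ∧ ProjTransverse zp (dualProjAct (ρ i γ) zm)) ∧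
      (∀ i : {i : I₂ // IsOfGeneralType (Set.range (σ i))}, ∀ yp ∈ Yp i, ∀ ym ∈ Ym i,
        σ i.1 γ • yp ≠ ym ∧ yp ≠ σ i.1 γ • ym)

end

/-!
All the transversality conditions say that a moved object is not below another one in a suitable
lattice. For a point `z⁺` and a hyperplane `z⁻` of `V`, they say `γ z⁺ ≰ z⁻` in the lattice of
subspaces of `V` and `γ z⁻ ≰ z⁺` in the opposite lattice; for boundary points, that `γ {y} ≰ {y'}`
in the lattice `PointLattice` made of the subsets of `∂∞M` that are subsingletons or everything.
Finitely many conditions thus amount to one element `x` of a finite product `P` of such lattices,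
and one asks for a `γ` such that, in each factor `j`, the coordinate of `γ x` is not below a given
`c j ≠ ⊤`.

Suppose there is no such `γ`. Then the orbit of `x` is covered by finitely many elements of `P`, all
different from `⊤`. Each lattice carries a strictly monotone, `Γ`-invariant rank with values in `ℕ`,
hence so does `P`. Among the finite covers take one whose maximal rank, and then whose number of
elements of maximal rank, is smallest. Comparing it with its meet with its translate by `γ⁻¹`, one
finds that its elements of maximal rank are permuted by `Γ`
(`exists_invariant_finset_of_cover`). This is a substitute for Neumann's lemma on coverings by
cosets which needs no inverses in `Γ` and treats all factors at once.
The coordinates in a given factor of these elements form a finite invariant set, so they are all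
`⊤` (`IsRigid.eq_top`): for subspaces this is strong irreducibility, and for the boundary it holds
because a finite subset of `∂∞M` invariant under a hyperbolic isometry `g` consists of fixed points
of `g`. So the elements of maximal rank equal `⊤`, which is absurd: by minimality their rank is at
most the maximal rank of the initial cover, hence less than that of `⊤`.
-/

/-! ### Finite covers of an orbit in a ranked semilattice -/

section Covers

variable {Γ : Type*}

/-- The order automorphisms `e γ` preserve some strictly monotone function with values in `ℕ`. -/
def HasInvariantRank {P : Type*} [Preorder P] (e : Γ → P ≃o P) : Prop :=
  ∃ rk : P → ℕ, StrictMono rk ∧ ∀ γ b, rk (e γ b) = rk b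

/-- If a nonempty invariant set `O` is covered by finitely many elements of rank `< r`, then there
is a finite nonempty invariant set of elements of rank `< r`, each lying above an element of `O`. -/
theorem exists_invariant_finset_of_cover {P : Type*} [SemilatticeInf P] {e : Γ → P ≃o P}
    {rk : P → ℕ} (hrk : StrictMono rk) (he : ∀ γ b, rk (e γ b) = rk b)
    {O : Set P} (hO : O.Nonempty) (heO : ∀ γ, ∀ z ∈ O, e γ z ∈ O)
    {F₀ : Finset P} (hF₀ : ∀ z ∈ O, ∃ b ∈ F₀, z ≤ b) {r : ℕ} (hr : ∀ b ∈ F₀, rk b < r) :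
    ∃ F : Finset P, F.Nonempty ∧ (∀ γ, ∀ b ∈ F, e γ b ∈ F) ∧
      ∀ b ∈ F, rk b < r ∧ ∃ z ∈ O, z ≤ b := by
  classical
  let Cov : Finset P → Prop := fun F => ∀ z ∈ O, ∃ b ∈ F, z ≤ b
  let top : ℕ → Finset P → Finset P := fun s F => F.filter (fun b => rk b = s)
  obtain ⟨F, hF, hmin⟩ := exists_minimalFor_of_wellFoundedLT Cov
    (fun F => toLex (F.sup rk, (top (F.sup rk) F).card)) ⟨F₀, hF₀⟩
  obtain ⟨z₀, hz₀⟩ := hO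
  have nonempty_of_cov : ∀ F', Cov F' → F'.Nonempty := fun F' h =>
    let ⟨b, hb, _⟩ := h z₀ hz₀
    ⟨b, hb⟩
  have hmin' : ∀ F', Cov F' → F.sup rk < F'.sup rk ∨ F.sup rk = F'.sup rk ∧
      (top (F.sup rk) F).card ≤ (top (F'.sup rk) F').card := by
    intro F' hF'
    rcases le_total (toLex (F.sup rk, (top (F.sup rk) F).card))
      (toLex (F'.sup rk, (top (F'.sup rk) F').card)) with h | h
    · exact Prod.Lex.le_iff.1 h
    · exact Prod.Lex.le_iff.1 (hmin hF' h)
  set s := F.sup rk with hs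
  have hle : ∀ b ∈ F, rk b ≤ s := fun b hb => Finset.le_sup hb
  have hcard : ∀ F', Cov F' → (∀ b ∈ F', rk b ≤ s) → (top s F).card ≤ (top s F').card := by
    intro F' hF' hle'
    have h1 : F'.sup rk ≤ s := Finset.sup_le hle'
    rcases hmin' F' hF' with h | ⟨h, h'⟩
    · omega
    · rwa [← h] at h'
  have hsr : s < r := by
    have h1 : F₀.sup rk < r := by
      obtain ⟨b, hb, hb'⟩ := Finset.exists_mem_eq_sup F₀ (nonempty_of_cov F₀ hF₀) rk
      exact hb' ▸ hr b hb
    rcases hmin' F₀ hF₀ with h | ⟨h, -⟩ <;> omega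
  refine ⟨top s F, ?_, ?_, ?_⟩
  · obtain ⟨b, hb, hb'⟩ := Finset.exists_mem_eq_sup F (nonempty_of_cov F hF) rk
    exact ⟨b, Finset.mem_filter.2 ⟨hb, hb'.symm⟩⟩
  · intro γ
    -- The pairwise meets of elements of `F` and of its translate by `γ⁻¹` form another cover.
    let F' : Finset P := Finset.image₂ (· ⊓ ·) F (F.image (e γ).symm)
    have hF' : Cov F' := by
      intro z hz
      obtain ⟨b, hb, hzb⟩ := hF z hz
      obtain ⟨b', hb', hzb'⟩ := hF _ (heO γ z hz)
      exact ⟨_, Finset.mem_image₂_of_mem hb (Finset.mem_image_of_mem _ hb'),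
        le_inf hzb ((e γ).le_symm_apply.2 hzb')⟩
    have hle' : ∀ b ∈ F', rk b ≤ s := by
      intro c hc
      obtain ⟨b, hb, b', -, rfl⟩ := Finset.mem_image₂.1 hc
      exact (hrk.monotone inf_le_left).trans (hle b hb)
    have key : ∀ c ∈ top s F', c ∈ top s F ∧ e γ c ∈ top s F := by
      intro c hc
      obtain ⟨hc, hcs⟩ := Finset.mem_filter.1 hc
      obtain ⟨b, hb, b'', hb'', rfl⟩ := Finset.mem_image₂.1 hc
      obtain ⟨b', hb', rfl⟩ := Finset.mem_image.1 hb''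
      have hrk' : rk ((e γ).symm b') = rk b' := by rw [← he γ, (e γ).apply_symm_apply]
      have h1 : b ⊓ (e γ).symm b' = b := by
        refine inf_le_left.eq_of_not_lt fun h => ?_
        have := hrk h
        have := hle b hb
        omega
      have h2 : b ⊓ (e γ).symm b' = (e γ).symm b' := by
        refine inf_le_right.eq_of_not_lt fun h => ?_
        have := hrk h
        have := hle b' hb'
        omega
      constructor
      · simp only [h1] at hcs ⊢
        exact Finset.mem_filter.2 ⟨hb, hcs⟩
      · simp only [h2, (e γ).apply_symm_apply] at hcs ⊢
        exact Finset.mem_filter.2 ⟨hb', hrk' ▸ hcs⟩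
    have heq : top s F' = top s F :=
      Finset.eq_of_subset_of_card_le (fun c hc => (key c hc).1) (hcard F' hF' hle')
    exact fun b hb => (key b (heq ▸ hb)).2
  · intro b hb
    have hb' := Finset.mem_filter.1 hb
    refine ⟨hb'.2 ▸ hsr, ?_⟩
    by_contra! hno
    have hcov : Cov (F.erase b) := by
      intro z hz
      obtain ⟨c, hc, hzc⟩ := hF z hz
      refine ⟨c, Finset.mem_erase.2 ⟨?_, hc⟩, hzc⟩
      rintro rfl
      exact hno z hz hzc
    have h1 := hcard _ hcov fun c hc => hle c (Finset.mem_of_mem_erase hc)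
    have h2 : top s (F.erase b) = (top s F).erase b := Finset.filter_erase _ _ _
    rw [h2] at h1
    exact absurd h1 (not_le.2 (Finset.card_erase_lt_of_mem hb))

end Covers

/-! ### Rigid actions on bounded orders, and their products -/

section Rigid

variable {Γ : Type*}

/-- The automorphisms `e γ` preserve a rank, and every finite nonempty invariant set of elements
different from `⊥` contains `⊤`. -/
structure IsRigid {Q : Type*} [PartialOrder Q] [BoundedOrder Q] (e : Γ → Q ≃o Q) : Prop where
  hasInvariantRank : HasInvariantRank e
  top_mem : ∀ S : Finset Q, S.Nonempty → (∀ γ, ∀ b ∈ S, e γ b ∈ S) → ⊥ ∉ S → ⊤ ∈ S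

/-- If an equivariant map `π` to a rigid action does not take the value `⊥` on a finite invariant
set, then it is constant equal to `⊤` there. -/
theorem IsRigid.eq_top {Q : Type*} [PartialOrder Q] [BoundedOrder Q] {e : Γ → Q ≃o Q}
    (he : IsRigid e) {P : Type*} {f : Γ → P → P} {π : P → Q} (hπ : ∀ γ b, π (f γ b) = e γ (π b))
    {F : Finset P} (hF : ∀ γ, ∀ b ∈ F, f γ b ∈ F) (hbot : ∀ b ∈ F, π b ≠ ⊥) {b : P} (hb : b ∈ F) :
    π b = ⊤ := by
  classical
  obtain ⟨rk, hrk, hinv⟩ := he.hasInvariantRank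
  -- Restricting to one value of the rank shows that all elements, not just one, are `⊤`.
  have h := he.top_mem ((F.image π).filter fun q => rk q = rk (π b))
    ⟨π b, Finset.mem_filter.2 ⟨Finset.mem_image_of_mem _ hb, rfl⟩⟩ ?_ ?_
  · by_contra hne
    exact (hrk (lt_top_iff_ne_top.2 hne)).ne' (Finset.mem_filter.1 h).2
  · intro γ q hq
    obtain ⟨hq, hq'⟩ := Finset.mem_filter.1 hq
    obtain ⟨c, hc, rfl⟩ := Finset.mem_image.1 hq
    exact Finset.mem_filter.2 ⟨Finset.mem_image.2 ⟨_, hF γ c hc, hπ γ c⟩, (hinv γ _).trans hq'⟩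
  · intro h
    obtain ⟨c, hc, hc'⟩ := Finset.mem_image.1 (Finset.mem_filter.1 h).1
    exact hbot c hc hc'

/-- The automorphism of a product of orders given by an automorphism of each factor. -/
def piOrderIso {J : Type*} {P : J → Type*} [∀ j, Preorder (P j)] (e : ∀ j, P j ≃o P j) :
    (∀ j, P j) ≃o (∀ j, P j) where
  toEquiv := Equiv.piCongrRight fun j => (e j).toEquiv
  map_rel_iff' := forall_congr' fun j => (e j).le_iff_le

/-- The automorphism of a product of two orders given by an automorphism of each factor. -/
def prodOrderIso {P Q : Type*} [Preorder P] [Preorder Q] (e : P ≃o P) (f : Q ≃o Q) :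
    P × Q ≃o P × Q where
  toEquiv := Equiv.prodCongr e.toEquiv f.toEquiv
  map_rel_iff' := and_congr e.le_iff_le f.le_iff_le

theorem HasInvariantRank.pi {J : Type*} [Finite J] {P : J → Type*} [∀ j, PartialOrder (P j)]
    {e : ∀ j, Γ → P j ≃o P j} (h : ∀ j, HasInvariantRank (e j)) :
    HasInvariantRank fun γ => piOrderIso fun j => e j γ := by
  have := Fintype.ofFinite J
  choose rk hrk hinv using h
  refine ⟨fun b => ∑ j, rk j (b j), fun b c hbc => ?_,
    fun γ b => Finset.sum_congr rfl fun j _ => hinv j γ (b j)⟩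
  obtain ⟨hle, j, hj⟩ := Pi.lt_def.1 hbc
  exact Finset.sum_lt_sum (fun j _ => (hrk j).monotone (hle j)) ⟨j, Finset.mem_univ j, hrk j hj⟩

theorem HasInvariantRank.prod {P Q : Type*} [PartialOrder P] [PartialOrder Q]
    {e : Γ → P ≃o P} {f : Γ → Q ≃o Q} (he : HasInvariantRank e) (hf : HasInvariantRank f) :
    HasInvariantRank fun γ => prodOrderIso (e γ) (f γ) := by
  obtain ⟨rk, hrk, hinv⟩ := he
  obtain ⟨rk', hrk', hinv'⟩ := hf
  refine ⟨fun b => rk b.1 + rk' b.2, fun b c hbc => ?_,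
    fun γ b => congrArg₂ (· + ·) (hinv γ b.1) (hinv' γ b.2)⟩
  rcases Prod.lt_iff.1 hbc with ⟨h1, h2⟩ | ⟨h1, h2⟩
  · exact add_lt_add_of_lt_of_le (hrk h1) (hrk'.monotone h2)
  · exact add_lt_add_of_le_of_lt (hrk.monotone h1) (hrk' h2)

/-- Given rigid actions of `Γ` indexed by three finite sets, one `γ` moves finitely many elements
`x j ≠ ⊥` to elements not below given `c j ≠ ⊤`. Three families are allowed so that they may live in
different universes. -/
theorem exists_forall_not_le [Semigroup Γ] [Nonempty Γ]
    {A B C : Type*} [Finite A] [Finite B] [Finite C]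
    {P : A → Type*} {Q : B → Type*} {R : C → Type*}
    [∀ a, SemilatticeInf (P a)] [∀ b, SemilatticeInf (Q b)] [∀ c, SemilatticeInf (R c)]
    [∀ a, BoundedOrder (P a)] [∀ b, BoundedOrder (Q b)] [∀ c, BoundedOrder (R c)]
    {e : ∀ a, Γ → P a ≃o P a} {f : ∀ b, Γ → Q b ≃o Q b} {g : ∀ c, Γ → R c ≃o R c}
    (he : ∀ a, IsRigid (e a)) (hf : ∀ b, IsRigid (f b)) (hg : ∀ c, IsRigid (g c))
    (e_mul : ∀ a γ γ' x, e a (γ * γ') x = e a γ (e a γ' x))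
    (f_mul : ∀ b γ γ' x, f b (γ * γ') x = f b γ (f b γ' x))
    (g_mul : ∀ c γ γ' x, g c (γ * γ') x = g c γ (g c γ' x))
    {x p : ∀ a, P a} {y q : ∀ b, Q b} {z r : ∀ c, R c}
    (hx : ∀ a, x a ≠ ⊥) (hy : ∀ b, y b ≠ ⊥) (hz : ∀ c, z c ≠ ⊥)
    (hp : ∀ a, p a ≠ ⊤) (hq : ∀ b, q b ≠ ⊤) (hr : ∀ c, r c ≠ ⊤) :
    ∃ γ, (∀ a, ¬ e a γ (x a) ≤ p a) ∧ (∀ b, ¬ f b γ (y b) ≤ q b) ∧ ∀ c, ¬ g c γ (z c) ≤ r c := by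
  classical
  have := Fintype.ofFinite A
  have := Fintype.ofFinite B
  have := Fintype.ofFinite C
  let E : Γ → _ ≃o ((∀ a, P a) × (∀ b, Q b) × (∀ c, R c)) := fun γ =>
    prodOrderIso (piOrderIso fun a => e a γ)
      (prodOrderIso (piOrderIso fun b => f b γ) (piOrderIso fun c => g c γ))
  obtain ⟨rk, hrk, hinv⟩ : HasInvariantRank E :=
    (HasInvariantRank.pi fun a => (he a).hasInvariantRank).prod
      ((HasInvariantRank.pi fun b => (hf b).hasInvariantRank).prod
        (HasInvariantRank.pi fun c => (hg c).hasInvariantRank))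
  let X : (∀ a, P a) × (∀ b, Q b) × (∀ c, R c) := (x, y, z)
  have E_mul : ∀ γ γ', E (γ * γ') X = E γ (E γ' X) := fun γ γ' =>
    Prod.ext (funext fun a => e_mul a γ γ' _)
      (Prod.ext (funext fun b => f_mul b γ γ' _) (funext fun c => g_mul c γ γ' _))
  by_contra! hno
  -- The failure of one condition confines an element to a set which is everything in all factors
  -- but one.
  let F₀ : Finset ((∀ a, P a) × (∀ b, Q b) × (∀ c, R c)) :=
    (Finset.univ.image fun a => (Function.update ⊤ a (p a), ⊤, ⊤)) ∪
      ((Finset.univ.image fun b => (⊤, Function.update ⊤ b (q b), ⊤)) ∪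
        (Finset.univ.image fun c => (⊤, ⊤, Function.update ⊤ c (r c))))
  have hF₀ : ∀ w ∈ Set.range fun γ => E γ X, ∃ b ∈ F₀, w ≤ b := by
    rintro _ ⟨γ, rfl⟩
    by_cases h1 : ∃ a, e a γ (x a) ≤ p a
    · obtain ⟨a, ha⟩ := h1
      exact ⟨_, Finset.mem_union_left _ (Finset.mem_image_of_mem _ (Finset.mem_univ a)),
        le_update_iff.2 ⟨ha, fun _ _ => le_top⟩, le_top, le_top⟩
    by_cases h2 : ∃ b, f b γ (y b) ≤ q b
    · obtain ⟨b, hb⟩ := h2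
      exact ⟨_, Finset.mem_union_right _ (Finset.mem_union_left _
        (Finset.mem_image_of_mem _ (Finset.mem_univ b))),
        le_top, le_update_iff.2 ⟨hb, fun _ _ => le_top⟩, le_top⟩
    push Not at h1 h2
    obtain ⟨c, hc⟩ := hno γ h1 h2
    exact ⟨_, Finset.mem_union_right _ (Finset.mem_union_right _
      (Finset.mem_image_of_mem _ (Finset.mem_univ c))),
      le_top, le_top, le_update_iff.2 ⟨hc, fun _ _ => le_top⟩⟩
  have hlt : ∀ b ∈ F₀, rk b < rk ⊤ := by
    intro b hb
    refine hrk (lt_top_iff_ne_top.2 ?_)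
    rintro rfl
    rcases Finset.mem_union.1 hb with hb | hb
    · obtain ⟨a, -, ha⟩ := Finset.mem_image.1 hb
      exact hp a (by simpa using congrFun (congrArg Prod.fst ha) a)
    rcases Finset.mem_union.1 hb with hb | hb
    · obtain ⟨a, -, ha⟩ := Finset.mem_image.1 hb
      exact hq a (by simpa using congrFun (congrArg (fun w => w.2.1) ha) a)
    · obtain ⟨a, -, ha⟩ := Finset.mem_image.1 hb
      exact hr a (by simpa using congrFun (congrArg (fun w => w.2.2) ha) a)
  obtain ⟨F, ⟨b, hb⟩, hFinv, hF⟩ := exists_invariant_finset_of_cover hrk hinv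
    (Set.range_nonempty _) (by rintro γ _ ⟨γ', rfl⟩; exact ⟨γ * γ', E_mul γ γ'⟩) hF₀ hlt
  refine (hF b hb).1.ne (congrArg rk ?_)
  refine Prod.ext (funext fun a => ?_) (Prod.ext (funext fun a => ?_) (funext fun a => ?_))
  · refine (he a).eq_top (f := fun γ => E γ) (π := fun w => w.1 a) (fun _ _ => rfl) hFinv
      (fun w hw h => ?_) hb
    obtain ⟨-, -, ⟨γ, rfl⟩, hle⟩ := hF w hw
    exact hx a ((map_eq_bot_iff (e a γ)).1 (le_bot_iff.1 (h ▸ hle.1 a)))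
  · refine (hf a).eq_top (f := fun γ => E γ) (π := fun w => w.2.1 a) (fun _ _ => rfl) hFinv
      (fun w hw h => ?_) hb
    obtain ⟨-, -, ⟨γ, rfl⟩, hle⟩ := hF w hw
    exact hy a ((map_eq_bot_iff (f a γ)).1 (le_bot_iff.1 (h ▸ hle.2.1 a)))
  · refine (hg a).eq_top (f := fun γ => E γ) (π := fun w => w.2.2 a) (fun _ _ => rfl) hFinv
      (fun w hw h => ?_) hb
    obtain ⟨-, -, ⟨γ, rfl⟩, hle⟩ := hF w hw
    exact hz a ((map_eq_bot_iff (g a γ)).1 (le_bot_iff.1 (h ▸ hle.2.2 a)))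

end Rigid

/-! ### Linear subspaces -/

section Subspaces

variable {Γ V : Type*} [AddCommGroup V] [Module ℝ V]

/-- The action of `GL(V)` on the lattice of linear subspaces of `V`. -/
def subspaceIso (g : LinearMap.GeneralLinearGroup ℝ V) : Submodule ℝ V ≃o Submodule ℝ V :=
  Submodule.orderIsoMapComap g.toLinearEquiv

theorem subspaceIso_apply (g : LinearMap.GeneralLinearGroup ℝ V) (W : Submodule ℝ V) :
    subspaceIso g W = W.map (g : V →ₗ[ℝ] V) := rfl

theorem subspaceIso_mul (g h : LinearMap.GeneralLinearGroup ℝ V) (W : Submodule ℝ V) :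
    subspaceIso (g * h) W = subspaceIso g (subspaceIso h W) :=
  Submodule.map_comp (h : V →ₗ[ℝ] V) (g : V →ₗ[ℝ] V) W

theorem finrank_subspaceIso (g : LinearMap.GeneralLinearGroup ℝ V) (W : Submodule ℝ V) :
    finrank ℝ (subspaceIso g W) = finrank ℝ W :=
  LinearEquiv.finrank_map_eq g.toLinearEquiv W

theorem submodule_smul (g : LinearMap.GeneralLinearGroup ℝ V) (z : ℙ ℝ V) :
    (g • z).submodule = subspaceIso g z.submodule := by
  induction z using Projectivization.ind with
  | h v hv =>
    rw [Projectivization.smul_mk, Projectivization.submodule_mk, Projectivization.submodule_mk,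
      subspaceIso_apply, Submodule.map_span, Set.image_singleton]
    rfl

theorem submodule_ne_bot (z : ℙ ℝ V) : z.submodule ≠ ⊥ := by
  rw [Projectivization.submodule_eq, Ne, Submodule.span_singleton_eq_bot]
  exact z.rep_nonzero

theorem dualCoannihilator_ne_top (z : ℙ ℝ (Dual ℝ V)) : z.submodule.dualCoannihilator ≠ ⊤ := by
  intro h
  refine z.rep_nonzero (LinearMap.ext fun v => ?_)
  have hv : v ∈ z.submodule.dualCoannihilator := h ▸ Submodule.mem_top
  refine (Submodule.mem_dualCoannihilator v).1 hv _ ?_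
  rw [Projectivization.submodule_eq]
  exact Submodule.mem_span_singleton_self _

theorem dualCoannihilator_dualProjAct (g : LinearMap.GeneralLinearGroup ℝ V)
    (z : ℙ ℝ (Dual ℝ V)) : (dualProjAct g z).submodule.dualCoannihilator =
      subspaceIso g z.submodule.dualCoannihilator := by
  have mem_iff : ∀ (φ : Dual ℝ V) (v : V), v ∈ (ℝ ∙ φ).dualCoannihilator ↔ φ v = 0 := by
    intro φ v
    rw [Submodule.mem_dualCoannihilator]
    refine ⟨fun h => h φ (Submodule.mem_span_singleton_self φ), fun h ψ hψ => ?_⟩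
    obtain ⟨c, rfl⟩ := Submodule.mem_span_singleton.1 hψ
    simp [h]
  induction z using Projectivization.ind with
  | h φ hφ =>
    ext v
    change v ∈ Submodule.dualCoannihilator
      (Projectivization.mk ℝ (g.toLinearEquiv.symm.dualMap φ) _).submodule ↔
        v ∈ Submodule.map (g.toLinearEquiv : V →ₗ[ℝ] V) _
    rw [Projectivization.submodule_mk, Projectivization.submodule_mk, mem_iff,
      Submodule.mem_map_equiv, mem_iff]
    rfl

/-- A finite nonempty invariant set of subspaces for a strongly irreducible set contains `⊥`
or `⊤`. -/
theorem ActsStronglyIrreducibly.top_mem {ρ : Γ → LinearMap.GeneralLinearGroup ℝ V}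
    (hρ : ActsStronglyIrreducibly (Set.range ρ)) {S : Finset (Submodule ℝ V)} (hS : S.Nonempty)
    (hinv : ∀ γ, ∀ W ∈ S, subspaceIso (ρ γ) W ∈ S) (hbot : ⊥ ∉ S) : ⊤ ∈ S := by
  have hunion : ∀ g ∈ Set.range ρ, ∀ v ∈ ⋃ W ∈ S, (W : Set V), g • v ∈ ⋃ W ∈ S, (W : Set V) := by
    rintro _ ⟨γ, rfl⟩ v hv
    obtain ⟨W, hW, hv⟩ := Set.mem_iUnion₂.1 hv
    exact Set.mem_iUnion₂.2 ⟨_, hinv γ W hW, Submodule.mem_map_of_mem hv⟩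
  rcases hρ S hS hunion with h | h
  · obtain ⟨W, hW⟩ := hS
    refine absurd ((Submodule.eq_bot_iff W).2 fun v hv => ?_) fun h' => hbot (h' ▸ hW)
    have : v ∈ ⋃ W ∈ S, (W : Set V) := Set.mem_iUnion₂.2 ⟨W, hW, hv⟩
    rwa [h] at this
  · exact Subspace.top_mem_of_biUnion_eq_univ h

variable [FiniteDimensional ℝ V]

theorem ActsStronglyIrreducibly.isRigid {ρ : Γ → LinearMap.GeneralLinearGroup ℝ V}
    (hρ : ActsStronglyIrreducibly (Set.range ρ)) : IsRigid fun γ => subspaceIso (ρ γ) where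
  hasInvariantRank := ⟨fun W => finrank ℝ W, Submodule.finrank_strictMono,
    fun γ W => finrank_subspaceIso (ρ γ) W⟩
  top_mem _ hS hinv hbot := hρ.top_mem hS hinv hbot

theorem ActsStronglyIrreducibly.isRigid_dual {ρ : Γ → LinearMap.GeneralLinearGroup ℝ V}
    (hρ : ActsStronglyIrreducibly (Set.range ρ)) :
    IsRigid fun γ => (subspaceIso (ρ γ)).dual where
  hasInvariantRank := by
    refine ⟨fun W => finrank ℝ V - finrank ℝ ↥(OrderDual.ofDual W : Submodule ℝ V), fun W W' h => ?_,
      fun γ W => congrArg (finrank ℝ V - ·) (finrank_subspaceIso (ρ γ) _)⟩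
    have h1 := Submodule.finrank_lt_finrank_of_lt (OrderDual.ofDual_lt_ofDual.2 h)
    have h2 := Submodule.finrank_le (OrderDual.ofDual W)
    dsimp only
    omega
  -- In the opposite lattice `⊥` and `⊤` are exchanged, so this is the contrapositive.
  top_mem S hS hinv hbot := by
    by_contra htop
    exact hbot (hρ.top_mem (S := S) hS hinv htop)

end Subspaces

/-! ### The lattice of points of a set -/

section Points

/-- The lattice whose elements are the empty set, the singletons and the whole of `X`. -/
def PointLattice (X : Type*) : Type _ := {s : Set X // s.Subsingleton ∨ s = Set.univ}

namespace PointLattice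

variable {X Γ : Type*}

instance : SemilatticeInf (PointLattice X) :=
  Subtype.semilatticeInf fun {s t} hs ht => by
    rcases hs with hs | rfl
    · exact Or.inl (hs.anti Set.inter_subset_left)
    · simpa only [Set.inf_eq_inter, Set.univ_inter] using ht

instance : BoundedOrder (PointLattice X) where
  top := ⟨Set.univ, Or.inr rfl⟩
  le_top s := Set.subset_univ s.1
  bot := ⟨∅, Or.inl Set.subsingleton_empty⟩
  bot_le s := Set.empty_subset s.1

/-- The element `{x}`. -/
def point (x : X) : PointLattice X := ⟨{x}, Or.inl Set.subsingleton_singleton⟩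

theorem eq_bot_or_eq_top_or_eq_point (s : PointLattice X) : s = ⊥ ∨ s = ⊤ ∨ ∃ x, s = point x := by
  obtain ⟨s, hs | rfl⟩ := s
  · obtain rfl | ⟨x, rfl⟩ := hs.eq_empty_or_singleton
    · exact Or.inl rfl
    · exact Or.inr (Or.inr ⟨x, rfl⟩)
  · exact Or.inr (Or.inl rfl)

theorem point_ne_bot (x : X) : point x ≠ ⊥ := fun h =>
  Set.singleton_ne_empty x (congrArg Subtype.val h)

theorem point_le_point {x y : X} : point x ≤ point y ↔ x = y := Set.singleton_subset_singleton

theorem point_injective : Function.Injective (point : X → PointLattice X) := fun _ _ h =>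
  point_le_point.1 h.le

theorem point_ne_top [Nontrivial X] (x : X) : point x ≠ ⊤ := by
  obtain ⟨y, hy⟩ := exists_ne x
  intro h
  exact hy (point_le_point.1 (h ▸ le_top))

/-- The automorphism of the lattice of points induced by a permutation. -/
def congr (e : Equiv.Perm X) : PointLattice X ≃o PointLattice X where
  toFun s := ⟨e '' s.1, s.2.imp (fun h => h.image e) fun h => by rw [h, Set.image_univ_of_surjective e.surjective]⟩
  invFun s := ⟨e.symm '' s.1,
    s.2.imp (fun h => h.image e.symm) fun h => by rw [h, Set.image_univ_of_surjective e.symm.surjective]⟩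
  left_inv s := Subtype.ext (e.symm_image_image s.1)
  right_inv s := Subtype.ext (e.image_symm_image s.1)
  map_rel_iff' := Set.image_subset_image_iff e.injective

theorem congr_point (e : Equiv.Perm X) (x : X) : congr e (point x) = point (e x) :=
  Subtype.ext Set.image_singleton

theorem hasInvariantRank (e : Γ → Equiv.Perm X) : HasInvariantRank fun γ => congr (e γ) := by
  classical
  refine ⟨fun s => if s = ⊥ then 0 else if s = ⊤ then 2 else 1, fun s t h => ?_, fun γ s => ?_⟩
  · have ht : t ≠ ⊥ := h.ne_bot
    have hs : s ≠ ⊤ := h.ne_top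
    obtain rfl | rfl | ⟨y, rfl⟩ := t.eq_bot_or_eq_top_or_eq_point
    · exact absurd rfl ht
    · simp only [if_neg ht, if_neg hs, if_true]
      split_ifs <;> omega
    · obtain rfl | rfl | ⟨x, rfl⟩ := s.eq_bot_or_eq_top_or_eq_point
      · simp only [if_neg ht, if_true]
        split_ifs <;> omega
      · exact absurd rfl hs
      · exact absurd (congrArg point (point_le_point.1 h.le)) h.ne
  · simp only [map_eq_bot_iff (congr (e γ)), map_eq_top_iff]

/-- If the permutations `e γ` preserve no finite nonempty set of points, the action on the lattice
of points is rigid. -/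
theorem isRigid {e : Γ → Equiv.Perm X}
    (he : ∀ T : Finset X, T.Nonempty → ¬ ∀ γ, ∀ x ∈ T, e γ x ∈ T) :
    IsRigid fun γ => congr (e γ) where
  hasInvariantRank := hasInvariantRank e
  top_mem S hS hinv hbot := by
    by_contra htop
    have hpt : ∀ s ∈ S, ∃ x, s = point x := fun s hs => by
      obtain rfl | rfl | h := s.eq_bot_or_eq_top_or_eq_point
      exacts [absurd hs hbot, absurd hs htop, h]
    refine he (S.preimage point point_injective.injOn) ?_ fun γ x hx => ?_
    · obtain ⟨s, hs⟩ := hS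
      obtain ⟨x, rfl⟩ := hpt s hs
      exact ⟨x, Finset.mem_preimage.2 hs⟩
    · rw [Finset.mem_preimage] at hx ⊢
      exact congr_point (e γ) x ▸ hinv γ _ hx

end PointLattice

end Points

/-! ### Actions of general type on the Gromov boundary -/

section Boundary

variable {M : Type*} [MetricSpace M] [GromovHyperbolic M]

/-- Boundary points with arbitrarily large Gromov product are equal. -/
theorem eq_of_forall_lt_extGromovProd {x y : GromovBoundary M}
    (h : ∀ (o : M) (t : ℝ), (t : EReal) < extGromovProd (Sum.inr x) (Sum.inr y) o) : x = y := by
  induction x using Quotient.inductionOn with | _ u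
  induction y using Quotient.inductionOn with | _ v
  refine Quotient.sound fun o => tendsto_atTop.2 fun t => ?_
  have h1 : extGromovProd (Sum.inr ⟦u⟧) (Sum.inr ⟦v⟧) o ≤
      liminf (fun n => ((gromovProd (u.1 n) (v.1 n) o : ℝ) : EReal)) atTop :=
    iInf₂_le_of_le u.1 ⟨u, rfl, rfl⟩ (iInf₂_le_of_le v.1 ⟨v, rfl, rfl⟩ le_rfl)
  filter_upwards [eventually_lt_of_lt_liminf ((h o t).trans_le h1)] with n hn
  exact (EReal.coe_lt_coe_iff.1 hn).le

/-- A boundary point with a finite forward orbit under a hyperbolic isometry `g` is fixed by `g`. -/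
theorem IsHyperbolicIsometry.smul_eq_of_finite {g : M ≃ᵢ M} (hg : IsHyperbolicIsometry g)
    {T : Finset (GromovBoundary M)} (hT : ∀ y ∈ T, g • y ∈ T) {y : GromovBoundary M}
    (hy : y ∈ T) : g • y = y := by
  obtain ⟨xp, xm, -, hxp, hxm, hconv, -⟩ := hg
  by_cases hne : y = xm
  · exact hne ▸ hxm
  suffices y = xp from this ▸ hxp
  have hmem : ∀ n : ℕ, g ^ n • y ∈ (T : Set (GromovBoundary M)) := by
    intro n
    induction n with
    | zero => simpa using hy
    | succ n ih => rw [pow_succ', mul_smul]; exact hT _ ih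
  obtain ⟨m, n, hmn, heq⟩ := T.finite_toSet.exists_lt_map_eq_of_forall_mem hmem
  have hfix : g ^ (n - m) • y = y := by
    have h1 : g ^ m • g ^ (n - m) • y = g ^ m • y := by
      rw [← mul_smul, ← pow_add, Nat.add_sub_cancel' hmn.le]
      exact heq.symm
    exact smul_left_cancel _ h1
  have hfix' : ∀ k : ℕ, g ^ ((n - m) * k) • y = y := by
    intro k
    induction k with
    | zero => simp
    | succ k ih => rw [Nat.mul_succ, pow_add, mul_smul, hfix, ih]
  -- The sequence `gⁿ y` converges to `xp` and takes the value `y` infinitely often.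
  refine eq_of_forall_lt_extGromovProd fun o t => ?_
  obtain ⟨N, hN⟩ := eventually_atTop.1 (hconv (Sum.inr y) (by simpa using hne) o t)
  have hlt := hN ((n - m) * N) (Nat.le_mul_of_pos_left N (Nat.sub_pos_of_lt hmn))
  have hact : bordAct (g ^ ((n - m) * N)) (Sum.inr y) = Sum.inr y :=
    congrArg Sum.inr (hfix' N)
  exact hact ▸ hlt

theorem IsOfGeneralType.not_invariant {S : Set (M ≃ᵢ M)} (hS : IsOfGeneralType S)
    (T : Finset (GromovBoundary M)) (hT : T.Nonempty) : ¬ ∀ g ∈ S, ∀ y ∈ T, g • y ∈ T := by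
  intro hinv
  obtain ⟨g, hgS, h, hhS, hg, hh, hno⟩ := hS
  obtain ⟨y, hy⟩ := hT
  exact hno y ⟨hg.smul_eq_of_finite (hinv g hgS) hy, hh.smul_eq_of_finite (hinv h hhS) hy⟩

theorem IsOfGeneralType.nontrivial {S : Set (M ≃ᵢ M)} (hS : IsOfGeneralType S) :
    Nontrivial (GromovBoundary M) := by
  obtain ⟨g, -, -, -, ⟨xp, xm, hne, -⟩, -⟩ := hS
  exact ⟨xp, xm, hne⟩

theorem IsOfGeneralType.isRigid {Γ : Type*} {σ : Γ → M ≃ᵢ M}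
    (hσ : IsOfGeneralType (Set.range σ)) :
    IsRigid fun γ => PointLattice.congr (MulAction.toPerm (σ γ) : Equiv.Perm (GromovBoundary M)) :=
  PointLattice.isRigid fun T hT hinv => hσ.not_invariant T hT <| by
    rintro _ ⟨γ, rfl⟩
    exact hinv γ

end Boundary

/-! ### Simultaneous transversality -/

theorem mainTheorem6 {Γ : Type*} [Semigroup Γ] [Nonempty Γ]
    {I₁ I₂ : Type*} [Finite I₁] [Finite I₂]
    {V : I₁ → Type*} [∀ i, NormedAddCommGroup (V i)] [∀ i, InnerProductSpace ℝ (V i)]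
    [∀ i, FiniteDimensional ℝ (V i)] (hdim : ∀ i, 2 ≤ Module.finrank ℝ (V i))
    (ρ : ∀ i, Γ →ₙ* LinearMap.GeneralLinearGroup ℝ (V i))
    (hρ : ∀ i, ActsStronglyIrreducibly (Set.range (ρ i)))
    {M : I₂ → Type*} [∀ i, MetricSpace (M i)] [∀ i, GromovHyperbolic (M i)]
    (σ : ∀ i, Γ →ₙ* (M i ≃ᵢ M i))
    (hσ : ∀ i, ¬ ∃! x : GromovBoundary (M i), ∀ γ : Γ, σ i γ • x = x) :
    ConditionStar ρ σ := by
  classical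
  intro Zp Zm Yp Ym
  have nontriv : ∀ i : {i : I₂ // IsOfGeneralType (Set.range (σ i))},
      Nontrivial (GromovBoundary (M i.1)) := fun i => i.2.nontrivial
  -- One factor for each pair to be made transverse: `A` indexes both kinds of conditions on a
  -- point and a hyperplane, and `C` contains each pair of boundary points in both orders.
  let A := Σ i, Zp i × Zm i
  let C := Σ i : {i : I₂ // IsOfGeneralType (Set.range (σ i))},
    ↥(Yp i ×ˢ Ym i ∪ Ym i ×ˢ Yp i)
  obtain ⟨γ, h1, h2, h3⟩ := exists_forall_not_le (Γ := Γ) (A := A) (B := A) (C := C)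
    (fun a => (hρ a.1).isRigid) (fun a => (hρ a.1).isRigid_dual) (fun c => c.1.2.isRigid)
    (fun a γ γ' W => by rw [map_mul]; exact subspaceIso_mul _ _ _)
    (fun a γ γ' W => by rw [map_mul]; exact subspaceIso_mul _ _ _)
    (fun c γ γ' s => by
      refine Subtype.ext ?_
      change (fun x => σ c.1.1 (γ * γ') • x) '' s.1 =
        (fun x => σ c.1.1 γ • x) '' ((fun x => σ c.1.1 γ' • x) '' s.1)
      simp only [map_mul, mul_smul, Set.image_image])
    (x := fun a => a.2.1.1.submodule) (p := fun a => a.2.2.1.submodule.dualCoannihilator)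
    (y := fun a => OrderDual.toDual a.2.2.1.submodule.dualCoannihilator)
    (q := fun a => OrderDual.toDual a.2.1.1.submodule)
    (z := fun c => PointLattice.point c.2.1.1) (r := fun c => PointLattice.point c.2.1.2)
    (fun a => submodule_ne_bot _) (fun a => dualCoannihilator_ne_top a.2.2.1)
    (fun c => PointLattice.point_ne_bot _) (fun a => dualCoannihilator_ne_top _)
    (fun a => submodule_ne_bot a.2.1.1) (fun c => PointLattice.point_ne_top _)
  refine ⟨γ, fun i zp hzp zm hzm => ⟨?_, ?_⟩, fun i yp hyp ym hym => ⟨?_, ?_⟩⟩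
  · rw [ProjTransverse, submodule_smul]
    exact h1 ⟨i, ⟨zp, hzp⟩, ⟨zm, hzm⟩⟩
  · rw [ProjTransverse, dualCoannihilator_dualProjAct]
    exact h2 ⟨i, ⟨zp, hzp⟩, ⟨zm, hzm⟩⟩
  · intro h
    refine h3 ⟨i, (yp, ym), Finset.mem_union_left _ (Finset.mk_mem_product hyp hym)⟩ ?_
    exact (PointLattice.congr_point _ _).trans_le (PointLattice.point_le_point.2 h)
  · intro h
    refine h3 ⟨i, (ym, yp), Finset.mem_union_right _ (Finset.mk_mem_product hym hyp)⟩ ?_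
    exact (PointLattice.congr_point _ _).trans_le (PointLattice.point_le_point.2 h.symm)
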